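/- For an integer $n\ge 3$ let $S_n$ be the graph of the convex polytope with the $4n$ vertices $a_i,b_i,c_i,d_i$ $(1\le i\le n)$ and edge set $$E(S_n)=\{a_ia_{i+1},\ b_ib_{i+1},\ c_ic_{i+1},\ d_id_{i+1},\ a_{i+1}b_i,\ a_ib_i,\ b_ic_i,\ c_id_i \mid 1\le i\le n\},$$ where indices are taken modulo $n$. For a finite connected graph $G$ with distance $d$, a set $W\subseteq V(G)$ is a local resolving set of $G$ if for every two adjacent vertices $u,v$ of $G$ there is $w\in W$ with $d(u,w)\ne d(v,w)$, and the local metric dimension $lmd(G)$ is the minimum cardinality of a local resolving set of $G$. Theorem. For every $n\ge 3$, $$lmd(S_n)=\begin{cases}2, & \text{if } n \text{ is odd},\\ 3, & \text{if } n\text{ is even}.\end{cases}$$ -/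

import Mathlib

/-- A vertex `w` resolves `u` and `v` if `d(u, w) ≠ d(v, w)`. -/
def SimpleGraph.Resolves {V : Type*} (G : SimpleGraph V) (w u v : V) : Prop :=
  G.dist u w ≠ G.dist v w

/-- `W` is a local resolving set of `G` if any two adjacent vertices of `G` are resolved by
some element of `W`. -/
def SimpleGraph.IsLocalResolvingSet {V : Type*} (G : SimpleGraph V) (W : Set V) : Prop :=
  ∀ u v : V, G.Adj u v → ∃ w ∈ W, G.Resolves w u v

/-- The local metric dimension of a (finite connected) graph: the minimum cardinality of a local
resolving set. -/
noncomputable def SimpleGraph.localMetricDim {V : Type*} (G : SimpleGraph V) : ℕ :=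
  sInf {k : ℕ | ∃ W : Finset V, W.card = k ∧ G.IsLocalResolvingSet (W : Set V)}

/-- The vertices `a_i, b_i, c_i, d_i` of the convex polytope `S_n`, with indices modulo `n`. -/
inductive SVertex (n : ℕ) : Type
  | a (i : ZMod n) : SVertex n
  | b (i : ZMod n) : SVertex n
  | c (i : ZMod n) : SVertex n
  | d (i : ZMod n) : SVertex n

/-- The list of (oriented) edges of `S_n`. -/
inductive SEdge (n : ℕ) : SVertex n → SVertex n → Prop
  | aa (i : ZMod n) : SEdge n (.a i) (.a (i + 1))
  | bb (i : ZMod n) : SEdge n (.b i) (.b (i + 1))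
  | cc (i : ZMod n) : SEdge n (.c i) (.c (i + 1))
  | dd (i : ZMod n) : SEdge n (.d i) (.d (i + 1))
  | ab_succ (i : ZMod n) : SEdge n (.a (i + 1)) (.b i)
  | ab (i : ZMod n) : SEdge n (.a i) (.b i)
  | bc (i : ZMod n) : SEdge n (.b i) (.c i)
  | cd (i : ZMod n) : SEdge n (.c i) (.d i)

/-- The graph of the convex polytope `S_n`. -/
def convexPolytopeS (n : ℕ) : SimpleGraph (SVertex n) :=
  SimpleGraph.fromRel (SEdge n)

/-! All distances have a closed form `sDist` in terms of `cycNorm (i - j)`. A single vertex never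
suffices: three distances on a triangle, pairwise within 1, cannot be pairwise distinct. For odd `n`
the pair `a 0`, `b 0` works. For `n = 2k`, each vertex of one of the two inner cycles has two
consecutive neighbours on the other. Seen from a vertex of that other cycle, these neighbours are at
distances differing by exactly 1, so the farther one ties with their common neighbour. Such ties
defeat every pair; `c j` and `d j` act on the inner edges like `b j`. -/

namespace SimpleGraph

variable {V : Type*} {G : SimpleGraph V}

/-- A function vanishing at `w` only, `1`-Lipschitz along edges and decreasing along some edge
away from `w`, is the distance to `w`. -/
theorem dist_eq_of_potential (f : V → ℕ) (w : V) (hw : f w = 0)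
    (hlip : ∀ u v, G.Adj u v → f u ≤ f v + 1)
    (hdesc : ∀ u, u ≠ w → ∃ v, G.Adj u v ∧ f v + 1 = f u) (u : V) : G.dist u w = f u := by
  have walk_le : ∀ {x y : V} (p : G.Walk x y), f x ≤ f y + p.length := by
    intro x y p
    induction p with
    | nil => simp
    | cons h p ih =>
      have := hlip _ _ h
      rw [Walk.length_cons]
      omega
  have exists_walk : ∀ (m : ℕ) (x : V), f x = m → ∃ p : G.Walk x w, p.length = m := by
    intro m
    induction m with
    | zero =>
      intro x hx
      by_cases hxw : x = w
      · subst hxw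
        exact ⟨Walk.nil, rfl⟩
      · obtain ⟨v, -, hv⟩ := hdesc x hxw
        omega
    | succ m ih =>
      intro x hx
      have hxw : x ≠ w := by
        rintro rfl
        omega
      obtain ⟨v, hadj, hv⟩ := hdesc x hxw
      obtain ⟨p, hp⟩ := ih v (by omega)
      exact ⟨Walk.cons hadj p, by rw [Walk.length_cons, hp]⟩
  obtain ⟨p, hp⟩ := exists_walk _ u rfl
  apply le_antisymm
  · exact hp ▸ dist_le p
  · obtain ⟨q, hq⟩ := p.reachable.exists_walk_length_eq_dist
    have := walk_le q
    omega

/-- A local resolving set of cardinality `m` realizes the local metric dimension as soon as no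
smaller finite set is locally resolving. -/
theorem localMetricDim_eq {m : ℕ} (W : Finset V) (hcard : W.card = m)
    (hW : G.IsLocalResolvingSet (W : Set V))
    (hmin : ∀ U : Finset V, U.card < m → ¬ G.IsLocalResolvingSet (U : Set V)) :
    G.localMetricDim = m := by
  apply le_antisymm
  · exact Nat.sInf_le ⟨W, hcard, hW⟩
  · refine le_csInf ⟨m, W, hcard, hW⟩ ?_
    rintro k ⟨U, rfl, hU⟩
    by_contra hlt
    exact hmin U (not_le.mp hlt) hU

end SimpleGraph

theorem Finset.exists_subset_pair_of_card_le_two {α : Type*} [Nonempty α] [DecidableEq α]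
    (U : Finset α) (h : U.card ≤ 2) : ∃ x y, U ⊆ {x, y} := by
  obtain ⟨z⟩ := ‹Nonempty α›
  have hc : U.card = 0 ∨ U.card = 1 ∨ U.card = 2 := by omega
  rcases hc with h0 | h1 | h2
  · rw [Finset.card_eq_zero] at h0
    exact ⟨z, z, by simp [h0]⟩
  · obtain ⟨x, rfl⟩ := Finset.card_eq_one.mp h1
    exact ⟨x, x, by simp⟩
  · obtain ⟨x, y, -, rfl⟩ := Finset.card_eq_two.mp h2
    exact ⟨x, y, subset_rfl⟩

/-! ### Residue arithmetic on the cycle -/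

namespace ZMod

variable {n : ℕ}

theorem val_add_eq_ite [NeZero n] (x y : ZMod n) :
    (x + y).val = if x.val + y.val < n then x.val + y.val else x.val + y.val - n := by
  split_ifs with h
  · exact val_add_of_lt h
  · exact val_add_of_le (not_lt.mp h)

theorem val_add_one_eq_ite (hn : 2 ≤ n) (x : ZMod n) :
    (x + 1).val = if x.val + 1 < n then x.val + 1 else 0 := by
  have : NeZero n := ⟨by omega⟩
  have : Fact (1 < n) := ⟨by omega⟩
  have hx := x.val_lt
  rw [val_add_eq_ite, val_one]
  split_ifs <;> omega

theorem val_sub_one_eq_ite (hn : 2 ≤ n) (x : ZMod n) :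
    (x - 1).val = if x.val = 0 then n - 1 else x.val - 1 := by
  have : NeZero n := ⟨by omega⟩
  have h := val_add_one_eq_ite hn (x - 1)
  have hlt := (x - 1).val_lt
  rw [sub_add_cancel] at h
  split_ifs at h ⊢ <;> omega

/-- The distance from `x` to `0` on the cycle `ZMod n`. -/
def cycNorm (x : ZMod n) : ℕ := min x.val (n - x.val)

end ZMod

/-! ### Distances in `S_n` -/

open ZMod

namespace SVertex

variable {n : ℕ}

/-- The distance in the graph `S_n`, in closed form. -/
def sDist : SVertex n → SVertex n → ℕ
  | a i, a j => cycNorm (i - j)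
  | a i, b j => min (cycNorm (i - j)) (cycNorm (i - j - 1)) + 1
  | a i, c j => min (cycNorm (i - j)) (cycNorm (i - j - 1)) + 2
  | a i, d j => min (cycNorm (i - j)) (cycNorm (i - j - 1)) + 3
  | b i, a j => min (cycNorm (i - j)) (cycNorm (i - j + 1)) + 1
  | b i, b j => cycNorm (i - j)
  | b i, c j => cycNorm (i - j) + 1
  | b i, d j => cycNorm (i - j) + 2
  | c i, a j => min (cycNorm (i - j)) (cycNorm (i - j + 1)) + 2
  | c i, b j => cycNorm (i - j) + 1
  | c i, c j => cycNorm (i - j)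
  | c i, d j => cycNorm (i - j) + 1
  | d i, a j => min (cycNorm (i - j)) (cycNorm (i - j + 1)) + 3
  | d i, b j => cycNorm (i - j) + 2
  | d i, c j => cycNorm (i - j) + 1
  | d i, d j => cycNorm (i - j)

theorem sDist_self (u : SVertex n) : sDist u u = 0 := by
  cases u <;> simp [sDist, cycNorm]

theorem sDist_edge (hn : 3 ≤ n) {u v : SVertex n} (h : SEdge n u v) (w : SVertex n) :
    sDist u w ≤ sDist v w + 1 ∧ sDist v w ≤ sDist u w + 1 := by
  have : NeZero n := ⟨by omega⟩
  have h2 : 2 ≤ n := by omega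
  cases h <;> rename_i i <;> cases w <;> rename_i j <;>
    simp only [sDist, cycNorm, add_sub_right_comm _ (1 : ZMod n) j, add_sub_cancel_right] <;>
    generalize i - j = x <;> have hx := x.val_lt <;>
    (try simp only [val_add_one_eq_ite h2, val_sub_one_eq_ite h2]) <;>
    (try split_ifs) <;> omega

end SVertex

open SVertex

section

variable {n : ℕ}

theorem SEdge.ne (hn : 3 ≤ n) {u v : SVertex n} (h : SEdge n u v) : u ≠ v := by
  have : Fact (1 < n) := ⟨by omega⟩
  cases h <;> simp

theorem SEdge.adj (hn : 3 ≤ n) {u v : SVertex n} (h : SEdge n u v) :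
    (convexPolytopeS n).Adj u v :=
  (SimpleGraph.fromRel_adj _ _ _).mpr ⟨h.ne hn, Or.inl h⟩

theorem SEdge.adj_pred (hn : 3 ≤ n) {C : ZMod n → SVertex n}
    (hC : ∀ i, SEdge n (C i) (C (i + 1))) (i : ZMod n) :
    (convexPolytopeS n).Adj (C i) (C (i - 1)) := by
  have h := (hC (i - 1)).adj hn
  rw [sub_add_cancel] at h
  exact h.symm

theorem SEdge.ab_pred_adj (hn : 3 ≤ n) (i : ZMod n) :
    (convexPolytopeS n).Adj (.a i) (.b (i - 1)) := by
  have h := (SEdge.ab_succ (i - 1)).adj hn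
  rwa [sub_add_cancel] at h

theorem cycNorm_descent (hn : 3 ≤ n) {x : ZMod n} (hx : x ≠ 0) :
    cycNorm (x + 1) + 1 = cycNorm x ∨ cycNorm (x - 1) + 1 = cycNorm x := by
  have : NeZero n := ⟨by omega⟩
  have h2 : 2 ≤ n := by omega
  have h0 : x.val ≠ 0 := by rwa [Ne, val_eq_zero]
  have hlt := x.val_lt
  simp only [cycNorm, val_add_one_eq_ite h2, val_sub_one_eq_ite h2]
  split_ifs <;> omega

/-- Descent towards `w` along one of the four cycles of `S_n`. -/
theorem sDist_descent_cycle (hn : 3 ≤ n) {C : ZMod n → SVertex n}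
    (hC : ∀ i, SEdge n (C i) (C (i + 1)))
    (hdist : ∀ i j, sDist (C i) (C j) = cycNorm (i - j)) {i j : ZMod n} (h : C i ≠ C j) :
    ∃ v, (convexPolytopeS n).Adj (C i) v ∧ sDist v (C j) + 1 = sDist (C i) (C j) := by
  have hij : i - j ≠ 0 := by
    rw [sub_ne_zero]
    rintro rfl
    exact h rfl
  rcases cycNorm_descent hn hij with h1 | h1
  · exact ⟨_, (hC i).adj hn, by rw [hdist, hdist, add_sub_right_comm, h1]⟩
  · exact ⟨_, SEdge.adj_pred hn hC i, by rw [hdist, hdist, sub_right_comm, h1]⟩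

theorem sDist_descent (hn : 3 ≤ n) {u w : SVertex n} (h : u ≠ w) :
    ∃ v, (convexPolytopeS n).Adj u v ∧ sDist v w + 1 = sDist u w := by
  have up_b (i : ZMod n) := (SEdge.bc i).adj hn
  have up_c (i : ZMod n) := (SEdge.cd i).adj hn
  -- This treats targets `b j`, `c j`, `d j` at once, with `m` the number of levels beyond the
  -- `b`-cycle.
  have out_a (i j : ZMod n) {m : ℕ} {w : SVertex n}
      (hw : ∀ l, sDist (.b l) w = cycNorm (l - j) + m)
      (ha : sDist (.a i) w = min (cycNorm (i - j)) (cycNorm (i - j - 1)) + (m + 1)) :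
      ∃ v, (convexPolytopeS n).Adj (.a i) v ∧ sDist v w + 1 = sDist (.a i) w := by
    rcases le_total (cycNorm (i - j)) (cycNorm (i - j - 1)) with hle | hle
    · exact ⟨_, (SEdge.ab i).adj hn, by rw [hw, ha, min_eq_left hle]; ring⟩
    · exact ⟨_, SEdge.ab_pred_adj hn i, by rw [hw, ha, min_eq_right hle, sub_right_comm]; ring⟩
  cases u <;> rename_i i <;> cases w <;> rename_i j
  · exact sDist_descent_cycle hn .aa (fun _ _ => rfl) h
  · exact out_a i j (m := 0) (fun _ => rfl) rfl
  · exact out_a i j (m := 1) (fun _ => rfl) rfl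
  · exact out_a i j (m := 2) (fun _ => rfl) rfl
  · rcases le_total (cycNorm (i - j)) (cycNorm (i - j + 1)) with hle | hle
    · exact ⟨_, ((SEdge.ab i).adj hn).symm, by simp only [sDist, min_eq_left hle]⟩
    · exact ⟨_, ((SEdge.ab_succ i).adj hn).symm, by
        simp only [sDist, min_eq_right hle, add_sub_right_comm]⟩
  · exact sDist_descent_cycle hn .bb (fun _ _ => rfl) h
  · exact ⟨_, up_b i, rfl⟩
  · exact ⟨_, up_b i, rfl⟩
  · exact ⟨_, (up_b i).symm, rfl⟩
  · exact ⟨_, (up_b i).symm, rfl⟩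
  · exact sDist_descent_cycle hn .cc (fun _ _ => rfl) h
  · exact ⟨_, up_c i, rfl⟩
  · exact ⟨_, (up_c i).symm, rfl⟩
  · exact ⟨_, (up_c i).symm, rfl⟩
  · exact ⟨_, (up_c i).symm, rfl⟩
  · exact sDist_descent_cycle hn .dd (fun _ _ => rfl) h

theorem convexPolytopeS_dist (hn : 3 ≤ n) (u w : SVertex n) :
    (convexPolytopeS n).dist u w = sDist u w := by
  refine SimpleGraph.dist_eq_of_potential (fun u => sDist u w) w (sDist_self w) ?_
    (fun u h => sDist_descent hn h) u
  intro u v huv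
  rcases ((SimpleGraph.fromRel_adj _ _ _).mp huv).2 with h | h
  · exact (sDist_edge hn h w).1
  · exact (sDist_edge hn h w).2

/-! ### Resolving sets of sizes 2 and 3 -/

theorem isLocalResolvingSet_of_sDist (hn : 3 ≤ n) {W : Set (SVertex n)}
    (h : ∀ u v, SEdge n u v → ∃ w ∈ W, sDist u w ≠ sDist v w) :
    (convexPolytopeS n).IsLocalResolvingSet W := by
  intro u v huv
  simp only [SimpleGraph.Resolves, convexPolytopeS_dist hn]
  rcases ((SimpleGraph.fromRel_adj _ _ _).mp huv).2 with h1 | h1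
  · exact h u v h1
  · obtain ⟨w, hw, hne⟩ := h v u h1
    exact ⟨w, hw, hne.symm⟩

theorem isLocalResolvingSet_pair (hn : 3 ≤ n) (hodd : Odd n) :
    (convexPolytopeS n).IsLocalResolvingSet {.a 0, .b 0} := by
  have : NeZero n := ⟨by omega⟩
  have h2 : 2 ≤ n := by omega
  obtain ⟨k, rfl⟩ := hodd
  refine isLocalResolvingSet_of_sDist hn fun u v huv => ?_
  simp only [Set.mem_insert_iff, Set.mem_singleton_iff, exists_eq_or_imp, exists_eq_left]
  cases huv <;> rename_i x <;> have hx := x.val_lt <;>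
    simp only [sDist, cycNorm, sub_zero, add_sub_cancel_right, val_add_one_eq_ite h2,
      val_sub_one_eq_ite h2] <;>
    split_ifs <;> omega

/-- For `n = 2k`, the only edge that both `a 0` and `b 0` miss is `a k`–`b k`; `a 1` resolves it. -/
theorem isLocalResolvingSet_triple (hn : 3 ≤ n) (heven : Even n) :
    (convexPolytopeS n).IsLocalResolvingSet {.a 0, .b 0, .a 1} := by
  have : NeZero n := ⟨by omega⟩
  have h2 : 2 ≤ n := by omega
  obtain ⟨k, rfl⟩ := heven
  refine isLocalResolvingSet_of_sDist hn fun u v huv => ?_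
  simp only [Set.mem_insert_iff, Set.mem_singleton_iff, exists_eq_or_imp, exists_eq_left]
  cases huv <;> rename_i x <;> have hx := x.val_lt <;>
    simp only [sDist, cycNorm, sub_zero, add_sub_cancel_right, sub_add_cancel,
      val_add_one_eq_ite h2, val_sub_one_eq_ite h2] <;>
    split_ifs <;> omega

/-! ### Lower bounds -/

/-- No vertex resolves all edges of the triangle `a_0 a_1 b_0`. -/
theorem exists_edge_sDist_eq (hn : 3 ≤ n) (w : SVertex n) :
    ∃ u v, SEdge n u v ∧ sDist u w = sDist v w := by
  by_contra! h
  have h1 := h _ _ (.aa 0)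
  have h2 := h _ _ (.ab 0)
  have h3 := h _ _ (.ab_succ 0)
  have := sDist_edge hn (.aa 0) w
  have := sDist_edge hn (.ab 0) w
  have := sDist_edge hn (.ab_succ 0) w
  omega

/-- Distances from `w` to the vertices `a_i` and `b_i` exceed those from `b_j` by a constant. -/
def IsAbove (w : SVertex n) (j : ZMod n) : Prop :=
  ∃ m, (∀ i, sDist (.a i) w = min (cycNorm (i - j)) (cycNorm (i - j - 1)) + 1 + m) ∧
    ∀ i, sDist (.b i) w = cycNorm (i - j) + m

theorem exists_eq_a_or_isAbove (w : SVertex n) : ∃ j, w = .a j ∨ IsAbove w j := by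
  cases w <;> rename_i j
  · exact ⟨j, Or.inl rfl⟩
  · exact ⟨j, Or.inr ⟨0, fun _ => rfl, fun _ => rfl⟩⟩
  · exact ⟨j, Or.inr ⟨1, fun _ => rfl, fun _ => rfl⟩⟩
  · exact ⟨j, Or.inr ⟨2, fun _ => rfl, fun _ => rfl⟩⟩

theorem val_sub_comm_eq_ite [NeZero n] (i j : ZMod n) :
    (i - j).val = if (j - i).val = 0 then 0 else n - (j - i).val := by
  have h := val_add_eq_ite (i - j) (j - i)
  have h1 := (i - j).val_lt
  have h2 := (j - i).val_lt
  rw [sub_add_sub_cancel, sub_self, val_zero] at h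
  split_ifs at h ⊢ <;> omega

section Even

variable {k : ℕ}

/-- Seen from `a i`, `b x` ties with the farther of `a x` and `a (x + 1)`. With `sDist_a_eq_b_of_a`
this covers every `x`. -/
theorem sDist_a_succ_eq_b_of_a (hn : 3 ≤ k + k) {x i : ZMod (k + k)} (h : (x - i).val < k) :
    sDist (.a (x + 1)) (.a i) = sDist (.b x) (.a i) := by
  simp only [sDist, cycNorm, add_sub_right_comm _ (1 : ZMod (k + k)) i,
    val_add_one_eq_ite (show 2 ≤ k + k by omega)]
  split_ifs <;> omega

theorem sDist_a_eq_b_of_a (hn : 3 ≤ k + k) {x i : ZMod (k + k)} (h : k ≤ (x - i).val) :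
    sDist (.a x) (.a i) = sDist (.b x) (.a i) := by
  have : NeZero (k + k) := ⟨by omega⟩
  have hx := (x - i).val_lt
  simp only [sDist, cycNorm, val_add_one_eq_ite (show 2 ≤ k + k by omega)]
  split_ifs <;> omega

theorem sDist_b_eq_b_succ_of_a (hn : 3 ≤ k + k) {x i : ZMod (k + k)}
    (h : (x - i).val + 1 = k ∨ (x - i).val + 1 = k + k) :
    sDist (.b x) (.a i) = sDist (.b (x + 1)) (.a i) := by
  simp only [sDist, cycNorm, add_sub_right_comm _ (1 : ZMod (k + k)) i,
    val_add_one_eq_ite (show 2 ≤ k + k by omega)]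
  split_ifs <;> omega

/-- Dually, `a x` ties with the farther of `b x` and `b (x - 1)`; in this range that is `b x`. -/
theorem IsAbove.sDist_a_eq_b (hn : 3 ≤ k + k) {w : SVertex (k + k)} {x j : ZMod (k + k)}
    (hw : IsAbove w j) (h1 : 1 ≤ (x - j).val) (h2 : (x - j).val ≤ k) :
    sDist (.a x) w = sDist (.b x) w := by
  obtain ⟨m, ha, hb⟩ := hw
  simp only [ha, hb, cycNorm, val_sub_one_eq_ite (show 2 ≤ k + k by omega)]
  split_ifs <;> omega

theorem IsAbove.sDist_a_succ_eq_b (hn : 3 ≤ k + k) {w : SVertex (k + k)} {x j : ZMod (k + k)}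
    (hw : IsAbove w j) (h : k ≤ (x - j).val) :
    sDist (.a (x + 1)) w = sDist (.b x) w := by
  have : NeZero (k + k) := ⟨by omega⟩
  obtain ⟨m, ha, hb⟩ := hw
  have hx := (x - j).val_lt
  simp only [ha, hb, cycNorm, add_sub_right_comm _ (1 : ZMod (k + k)) j, add_sub_cancel_right,
    val_add_one_eq_ite (show 2 ≤ k + k by omega)]
  split_ifs <;> omega

theorem IsAbove.sDist_a_eq_a_succ (hn : 3 ≤ k + k) {w : SVertex (k + k)} {x j : ZMod (k + k)}
    (hw : IsAbove w j) (h : (x - j).val = 0 ∨ (x - j).val = k) :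
    sDist (.a x) w = sDist (.a (x + 1)) w := by
  obtain ⟨m, ha, -⟩ := hw
  simp only [ha, cycNorm, add_sub_right_comm _ (1 : ZMod (k + k)) j, add_sub_cancel_right,
    val_add_one_eq_ite (show 2 ≤ k + k by omega), val_sub_one_eq_ite (show 2 ≤ k + k by omega)]
  split_ifs <;> omega

theorem exists_edge_sDist_eq_of_a_a (hn : 3 ≤ k + k) (i j : ZMod (k + k)) :
    ∃ u v, SEdge (k + k) u v ∧ sDist u (.a i) = sDist v (.a i) ∧
      sDist u (.a j) = sDist v (.a j) := by
  have : NeZero (k + k) := ⟨by omega⟩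
  have h2 : 2 ≤ k + k := by omega
  have hself (l : ZMod (k + k)) : (l - l).val < k := by
    rw [sub_self, val_zero]
    omega
  rcases lt_trichotomy (j - i).val k with hlt | heq | hgt
  · exact ⟨_, _, .ab_succ j, sDist_a_succ_eq_b_of_a hn hlt, sDist_a_succ_eq_b_of_a hn (hself j)⟩
  -- When `i` and `j` are antipodal, the two `b`-neighbours of `a j` are equidistant from both
  -- vertices.
  · refine ⟨_, _, .bb (j - 1), sDist_b_eq_b_succ_of_a hn (Or.inl ?_),
      sDist_b_eq_b_succ_of_a hn (Or.inr ?_)⟩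
    · rw [sub_right_comm, val_sub_one_eq_ite h2]
      split_ifs <;> omega
    · rw [sub_right_comm, val_sub_one_eq_ite h2, sub_self, val_zero, if_pos rfl]
      omega
  · refine ⟨_, _, .ab_succ i, sDist_a_succ_eq_b_of_a hn (hself i), sDist_a_succ_eq_b_of_a hn ?_⟩
    rw [val_sub_comm_eq_ite]
    split_ifs <;> omega

theorem IsAbove.exists_edge_sDist_eq (hn : 3 ≤ k + k) {w w' : SVertex (k + k)}
    {i j : ZMod (k + k)} (hw : IsAbove w i) (hw' : IsAbove w' j) :
    ∃ u v, SEdge (k + k) u v ∧ sDist u w = sDist v w ∧ sDist u w' = sDist v w' := by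
  have : NeZero (k + k) := ⟨by omega⟩
  have h2 : 2 ≤ k + k := by omega
  have hsucc (l : ZMod (k + k)) : (l + 1 - l).val = 1 := by
    rw [add_sub_right_comm, val_add_one_eq_ite h2, sub_self, val_zero]
    split_ifs <;> omega
  have hcomm := val_sub_comm_eq_ite i j
  rcases lt_trichotomy (j - i).val k with hlt | heq | hgt
  · refine ⟨_, _, .ab (j + 1), hw.sDist_a_eq_b hn ?_ ?_, hw'.sDist_a_eq_b hn ?_ ?_⟩
    · rw [add_sub_right_comm, val_add_one_eq_ite h2]
      split_ifs <;> omega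
    · rw [add_sub_right_comm, val_add_one_eq_ite h2]
      split_ifs <;> omega
    · rw [hsucc]
    · rw [hsucc]
      omega
  · exact ⟨_, _, .aa j, hw.sDist_a_eq_a_succ hn (Or.inr heq),
      hw'.sDist_a_eq_a_succ hn (Or.inl (by rw [sub_self, val_zero]))⟩
  · have hlt := (j - i).val_lt
    rw [if_neg (by omega)] at hcomm
    refine ⟨_, _, .ab (i + 1), hw.sDist_a_eq_b hn ?_ ?_, hw'.sDist_a_eq_b hn ?_ ?_⟩
    · rw [hsucc]
    · rw [hsucc]
      omega
    · rw [add_sub_right_comm, val_add_one_eq_ite h2]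
      split_ifs <;> omega
    · rw [add_sub_right_comm, val_add_one_eq_ite h2]
      split_ifs <;> omega

theorem IsAbove.exists_edge_sDist_eq_of_a (hn : 3 ≤ k + k) {w : SVertex (k + k)}
    (i : ZMod (k + k)) {j : ZMod (k + k)} (hw : IsAbove w j) :
    ∃ u v, SEdge (k + k) u v ∧ sDist u (.a i) = sDist v (.a i) ∧ sDist u w = sDist v w := by
  have : NeZero (k + k) := ⟨by omega⟩
  -- At the antipode `x = j + k`, `w` misses both edges from `b x` to the `a`-cycle, and `a i`
  -- misses one of them.
  have hk : (k : ZMod (k + k)).val = k := val_natCast_of_lt (by omega)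
  have hj : (j + (k : ZMod (k + k)) - j).val = k := by rw [add_sub_cancel_left, hk]
  have hi : (j + (k : ZMod (k + k)) - i).val =
      if (j - i).val < k then (j - i).val + k else (j - i).val - k := by
    rw [add_sub_right_comm, val_add_eq_ite, hk]
    split_ifs <;> omega
  rcases lt_or_ge (j - i).val k with hlt | hge
  · rw [if_pos hlt] at hi
    exact ⟨_, _, .ab (j + (k : ZMod (k + k))), sDist_a_eq_b_of_a hn (by omega),
      hw.sDist_a_eq_b hn (by omega) (by omega)⟩
  · rw [if_neg (not_lt.mpr hge)] at hi
    have hlt := (j - i).val_lt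
    exact ⟨_, _, .ab_succ (j + (k : ZMod (k + k))), sDist_a_succ_eq_b_of_a hn (by omega),
      hw.sDist_a_succ_eq_b hn (by omega)⟩

/-- For even `n`, no two vertices of `S_n` form a local resolving set. -/
theorem exists_edge_sDist_eq_of_even (hn : 3 ≤ n) (heven : Even n) (w w' : SVertex n) :
    ∃ u v, SEdge n u v ∧ sDist u w = sDist v w ∧ sDist u w' = sDist v w' := by
  obtain ⟨k, rfl⟩ := heven
  obtain ⟨i, rfl | hw⟩ := exists_eq_a_or_isAbove w <;>
    obtain ⟨j, rfl | hw'⟩ := exists_eq_a_or_isAbove w'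
  · exact exists_edge_sDist_eq_of_a_a hn i j
  · exact hw'.exists_edge_sDist_eq_of_a hn i
  · obtain ⟨u, v, h, h1, h2⟩ := hw.exists_edge_sDist_eq_of_a hn j
    exact ⟨u, v, h, h2, h1⟩
  · exact hw.exists_edge_sDist_eq hn hw'

end Even

theorem not_isLocalResolvingSet_of_subset_pair (hn : 3 ≤ n) {U : Set (SVertex n)}
    {w w' : SVertex n} (hU : U ⊆ {w, w'})
    (h : ∃ u v, SEdge n u v ∧ sDist u w = sDist v w ∧ sDist u w' = sDist v w') :
    ¬ (convexPolytopeS n).IsLocalResolvingSet U := by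
  intro hres
  obtain ⟨u, v, he, h1, h2⟩ := h
  obtain ⟨x, hx, hne⟩ := hres u v (he.adj hn)
  rw [SimpleGraph.Resolves, convexPolytopeS_dist hn, convexPolytopeS_dist hn] at hne
  rcases hU hx with rfl | rfl
  · exact hne h1
  · exact hne h2

end

theorem theorem1 (n : ℕ) (hn : 3 ≤ n) :
    (Odd n → (convexPolytopeS n).localMetricDim = 2) ∧
      (Even n → (convexPolytopeS n).localMetricDim = 3) := by
  classical
  have : Fact (1 < n) := ⟨by omega⟩
  have : Nonempty (SVertex n) := ⟨.a 0⟩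
  refine ⟨fun hodd => ?_, fun heven => ?_⟩
  · refine SimpleGraph.localMetricDim_eq {.a 0, .b 0} (by simp)
      (by simpa using isLocalResolvingSet_pair hn hodd) fun U hU => ?_
    obtain ⟨w, hw⟩ := Finset.card_le_one_iff_subset_singleton.mp (Nat.le_of_lt_succ hU)
    obtain ⟨u, v, h, heq⟩ := exists_edge_sDist_eq hn w
    refine not_isLocalResolvingSet_of_subset_pair hn (w := w) (w' := w) ?_ ⟨u, v, h, heq, heq⟩
    exact fun x hx => by simpa using hw hx
  · refine SimpleGraph.localMetricDim_eq {.a 0, .b 0, .a 1} (by simp)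
      (by simpa using isLocalResolvingSet_triple hn heven) fun U hU => ?_
    obtain ⟨w, w', hw⟩ := U.exists_subset_pair_of_card_le_two (Nat.le_of_lt_succ hU)
    exact not_isLocalResolvingSet_of_subset_pair hn (fun x hx => by simpa using hw hx)
      (exists_edge_sDist_eq_of_even hn heven w w')
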